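/- Write $[N]=\{1,\dots,N\}$ and, for a probability distribution $D$ on $[N]$, $D(S)=\sum_{i\in S}D(i)$. A $\mathsf{COND}_D$ oracle takes a query set $S\subseteq[N]$ with $D(S)>0$ and returns a fresh random element $i\in S$ with probability $D(i)/D(S)$, independently of all previous calls; if $D(S)=0$ the oracle and the algorithm stop with failure. A $\mathsf{COND}$ algorithm is an adaptive randomized algorithm that makes calls to this oracle and has no other access to $D$; it is admissible if every query set is either $[N]$ or contains an element that was returned by an earlier call (so that it never fails). Let $0<\epsilon,\delta<1$. A randomized procedure that on an input $i\in[N]$ outputs either a number $\alpha\in[0,1]$ or the symbol $\mathsf{UNKNOWN}$ is an $(\epsilon,\delta)$-approximate $\mathsf{EVAL}_D$ simulator with exceptional set $S\subsetneq[N]$ if $D(S)<\epsilon$ and, for every $i\in[N]$: (i) if $i\notin S$, then with probability at least $1-\delta$ the output on input $i$ is a number $\alpha\in[0,1]$ with $(1-\epsilon)D(i)\le\alpha\le(1+\epsilon)D(i)$; (ii) if $i\in S$, then with probability at least $1-\delta$ the output on input $i$ is either $\mathsf{UNKNOWN}$ or a number $\alpha\in[0,1]$ with $(1-\epsilon)D(i)\le\alpha\le(1+\epsilon)D(i)$.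 **Theorem.** There is an admissible $\mathsf{COND}$ algorithm (Approx-Eval-Simulator), which is given $N$, $\epsilon$, $\delta$ and an input point $i\in[N]$, with the following properties for every $N\ge 1$ and all $0<\epsilon,\delta<1$. It makes at most $$\tilde O\!\left(\frac{(\log N)^5\,(\log(1/\delta))^2}{\epsilon^3}\right)$$ calls to the oracle, whatever the answers and its coin tosses are. Moreover, for every distribution $D$ on $[N]$ and every $\epsilon$ there is a set $S^{(\epsilon,D)}\subsetneq[N]$, depending only on $\epsilon$ and $D$ (not on $\delta$ or $i$), such that for every $\delta$ the algorithm run with $\mathsf{COND}_D$ is an $(\epsilon,\delta)$-approximate $\mathsf{EVAL}_D$ simulator with exceptional set $S^{(\epsilon,D)}$. Here $\tilde O(f)$ means at most $C\,f\,(1+\log f)^k$ for absolute constants $C$ and $k$; logarithms in $f$ are binary, and one that is less than $1$ (which happens only if $N=1$ or $\delta>1/2$) is read as $1$. -/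

import Mathlib

/-- An adaptive randomized algorithm over the domain `[N]` with access to a conditional sampling
oracle, as a finite-depth decision tree: it can stop with an output, toss a fair coin of its own,
or send a query set `S` to the oracle and continue according to the element that is returned.
The unknown distribution is not an input: the tree sees it only through the oracle's answers. -/
inductive CondAlg (N : ℕ) (β : Type) : Type
  | ret (b : β) : CondAlg N β
  | coin (next : Bool → CondAlg N β) : CondAlg N β
  | query (S : Finset (Fin N)) (next : Fin N → CondAlg N β) : CondAlg N β

namespace CondAlg

variable {N : ℕ} {β : Type}

open Classical in
/-- The law of the output when the oracle is `COND_D`.  A query `S` with `D(S) > 0` is answered by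
a fresh draw from the conditional distribution `D_S`; on a query with `D(S) = 0` the oracle, and
with it the algorithm, stops with failure, which is the outcome `none`. -/
noncomputable def run (D : PMF (Fin N)) : CondAlg N β → PMF (Option β)
  | ret b => PMF.pure (some b)
  | coin next => (PMF.uniformOfFintype Bool).bind fun b => run D (next b)
  | query S next =>
      if h : ∃ i ∈ (S : Set (Fin N)), i ∈ D.support then
        (D.filter (S : Set (Fin N)) h).bind fun i => run D (next i)
      else PMF.pure none

/-- The number of oracle queries in the worst case over coin tosses and oracle answers. -/
def queries : CondAlg N β → ℕ
  | ret _ => 0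
  | coin next => Finset.univ.sup fun b => queries (next b)
  | query _ next => 1 + Finset.univ.sup fun i => queries (next i)

/-- Every query set is either the whole domain or contains an element that the oracle has returned
before; `seen` is the set of the elements returned so far. -/
def AdmissibleFrom : Finset (Fin N) → CondAlg N β → Prop
  | _, ret _ => True
  | seen, coin next => ∀ b, AdmissibleFrom seen (next b)
  | seen, query S next =>
      (S = Finset.univ ∨ ∃ i ∈ S, i ∈ seen) ∧ ∀ i ∈ S, AdmissibleFrom (insert i seen) (next i)

/-- Admissibility from the start, when nothing has been returned yet. -/
def Admissible (A : CondAlg N β) : Prop := A.AdmissibleFrom ∅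

end CondAlg

/-- An answer of an approximate evaluation oracle: a number in `[0, 1]` or `UNKNOWN`. -/
inductive EvalAnswer : Type
  | value (a : Set.Icc (0 : ℝ) 1) : EvalAnswer
  | unknown : EvalAnswer

/-- The weight `D(S)`. -/
noncomputable def weight {N : ℕ} (D : PMF (Fin N)) (S : Finset (Fin N)) : ℝ :=
  ∑ i ∈ S, (D i).toReal

/-- The outcomes that are a number `a` with `a ∈ [1 - ε, 1 + ε] D(i)`. -/
def accurateOutcomes {N : ℕ} (D : PMF (Fin N)) (ε : ℝ) (i : Fin N) : Set (Option EvalAnswer) :=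
  {o | ∃ a : Set.Icc (0 : ℝ) 1, o = some (EvalAnswer.value a) ∧
    (1 - ε) * (D i).toReal ≤ (a : ℝ) ∧ (a : ℝ) ≤ (1 + ε) * (D i).toReal}

/-- The randomized procedure `oracle` (input `i`, law of the outcome `oracle i`, with `none` for a
failed run) is an `(ε, δ)`-approximate `EVAL_D` simulator with exceptional set `S`. -/
structure IsApproxEvalSimulator {N : ℕ} (D : PMF (Fin N)) (ε δ : ℝ) (S : Finset (Fin N))
    (oracle : Fin N → PMF (Option EvalAnswer)) : Prop where
  ssubset_univ : S ⊂ Finset.univ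
  weight_lt : weight D S < ε
  never_fails : ∀ i, oracle i none = 0
  of_notMem : ∀ i, i ∉ S →
    ENNReal.ofReal (1 - δ) ≤ (oracle i).toOuterMeasure (accurateOutcomes D ε i)
  of_mem : ∀ i, i ∈ S →
    ENNReal.ofReal (1 - δ) ≤
      (oracle i).toOuterMeasure ({some EvalAnswer.unknown} ∪ accurateOutcomes D ε i)

/-- `(log N)^5 (log (1/δ))^2 / ε^3`, with binary logarithms.  A logarithm smaller than `1`
(which happens only for `N = 1` and for `δ > 1/2`) is replaced by `1`. -/
noncomputable def queryScale (N : ℕ) (ε δ : ℝ) : ℝ :=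
  (max 1 (Real.logb 2 N)) ^ 5 * (max 1 (Real.logb 2 (1 / δ))) ^ 2 / ε ^ 3

/-! Let `R` contain each point independently with probability `2^(-k)`. Conditioning on `j ∈ R`
amounts to inserting `j` by force, so `E[1_{j ∈ R} f(R)] = 2^(-k) E[f(R ∪ {j})]`. Taking `f(R) =
D(j) / D(R ∪ {i})` and summing over `j` gives an identity that is exact at every scale `k`: `2^(-k)
* hitProb = D(i) * missProb` (`half_pow_mul_hitProb`). Both probabilities belong to tests that the
oracle can perform, so `D(i)` is read off from the ratio of two empirical frequencies at any scale
where neither probability is too small.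

Such a scale exists if the points no heavier than `i` have total weight at least `ε`: for `2^(-k) <
D(i) ≤ 2 * 2^(-k)` the set `R ∪ {i, j}` typically weighs `O(D(i))` when `j` is no heavier than `i`,
so the hit probability is at least `ε / 3` (`le_hitProb`), and by the identity the miss probability
is at least `ε / 6` (`exists_good_scale`). The remaining points form the exceptional set; it is
contained in the level set of its heaviest member and therefore weighs less than `ε`.

The right scale is unknown, so all `O(log (N / ε))` of them are tried. A Chernoff bound
(`prob_misleading_le`) makes a count above the threshold certify a probability that is large enough
for a relative estimate; hence stopping at a wrong scale does no harm. Admissibility holds because a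
positive hit count means that `i` itself has been returned. -/

namespace CondAlg

variable {N : ℕ} {β γ : Type}

/-! ### Composition, admissibility and query counts of decision trees -/

/-- Sequential composition of algorithms. -/
def bind : CondAlg N β → (β → CondAlg N γ) → CondAlg N γ
  | ret b, f => f b
  | coin next, f => coin fun b => bind (next b) f
  | query S next, f => query S fun i => bind (next i) f

/-- The expectation of `φ` of the output, where failed runs contribute `0`. -/
noncomputable def expect (D : PMF (Fin N)) : CondAlg N β → (β → ℝ) → ℝ
  | ret b, φ => φ b
  | coin next, φ => (expect D (next true) φ + expect D (next false) φ) / 2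
  | query S next, φ => ∑ i ∈ S, (D i).toReal / weight D S * expect D (next i) φ

/-- Admissibility together with a property of the output and of the set of elements returned
during the run. -/
def Safe : Finset (Fin N) → CondAlg N β → (Finset (Fin N) → β → Prop) → Prop
  | seen, ret b, Q => Q seen b
  | seen, coin next, Q => ∀ b, Safe seen (next b) Q
  | seen, query S next, Q =>
      (S = Finset.univ ∨ ∃ i ∈ S, i ∈ seen) ∧ ∀ i ∈ S, Safe (insert i seen) (next i) Q

theorem Safe.admissibleFrom {A : CondAlg N β} {Q : Finset (Fin N) → β → Prop} :
    ∀ {seen : Finset (Fin N)}, A.Safe seen Q → A.AdmissibleFrom seen := by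
  induction A with
  | ret b => intro _ _; trivial
  | coin next ih => intro _ h b; exact ih b (h b)
  | query S next ih => intro _ h; exact ⟨h.1, fun i hi => ih i (h.2 i hi)⟩

theorem Safe.bind {A : CondAlg N β} {f : β → CondAlg N γ} {Q : Finset (Fin N) → β → Prop}
    {Q' : Finset (Fin N) → γ → Prop} (hf : ∀ s b, Q s b → (f b).Safe s Q') :
    ∀ {seen : Finset (Fin N)}, A.Safe seen Q → (A.bind f).Safe seen Q' := by
  induction A with
  | ret b => intro s h; exact hf s b h
  | coin next ih => intro _ h b; exact ih b (h b)
  | query S next ih => intro _ h; exact ⟨h.1, fun i hi => ih i (h.2 i hi)⟩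

theorem queries_bind_le {A : CondAlg N β} {f : β → CondAlg N γ} {n : ℕ}
    (hf : ∀ b, (f b).queries ≤ n) : (A.bind f).queries ≤ A.queries + n := by
  induction A with
  | ret b => simpa [CondAlg.bind, queries] using hf b
  | coin next ih =>
    refine Finset.sup_le fun b _ => (ih b).trans ?_
    have : (next b).queries ≤ (coin next).queries :=
      Finset.le_sup (f := fun b => (next b).queries) (Finset.mem_univ b)
    lia
  | query S next ih =>
    have h : (Finset.univ.sup fun i => ((next i).bind f).queries) ≤
        (Finset.univ.sup fun i => (next i).queries) + n := by
      refine Finset.sup_le fun b _ => (ih b).trans ?_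
      have : (next b).queries ≤ Finset.univ.sup fun i => (next i).queries :=
        Finset.le_sup (f := fun b => (next b).queries) (Finset.mem_univ b)
      lia
    simp only [CondAlg.bind, queries]
    lia

/-! ### Expectations and probabilities of outputs -/

section Expectation

variable (D : PMF (Fin N))

theorem weight_nonneg (S : Finset (Fin N)) : 0 ≤ weight D S :=
  Finset.sum_nonneg fun _ _ => ENNReal.toReal_nonneg

theorem weight_mono {S T : Finset (Fin N)} (h : S ⊆ T) : weight D S ≤ weight D T :=
  Finset.sum_le_sum_of_subset_of_nonneg h fun _ _ _ => ENNReal.toReal_nonneg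

theorem weight_univ : weight D Finset.univ = 1 := by
  unfold weight
  rw [← ENNReal.toReal_sum fun i _ => D.apply_ne_top i, ← tsum_fintype (L := .unconditional _),
    D.tsum_coe, ENNReal.toReal_one]

theorem ofReal_weight (S : Finset (Fin N)) : ENNReal.ofReal (weight D S) = ∑ i ∈ S, D i := by
  unfold weight
  rw [ENNReal.ofReal_sum_of_nonneg fun _ _ => ENNReal.toReal_nonneg]
  exact Finset.sum_congr rfl fun i _ => ENNReal.ofReal_toReal (D.apply_ne_top i)

theorem expect_bind (A : CondAlg N β) (f : β → CondAlg N γ) (φ : γ → ℝ) :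
    (A.bind f).expect D φ = A.expect D fun b => (f b).expect D φ := by
  induction A with
  | ret b => rfl
  | coin next ih => simp only [CondAlg.bind, expect, ih]
  | query S next ih => simp only [CondAlg.bind, expect, ih]

theorem expect_mono (A : CondAlg N β) {φ ψ : β → ℝ} (h : ∀ b, φ b ≤ ψ b) :
    A.expect D φ ≤ A.expect D ψ := by
  induction A with
  | ret b => exact h b
  | coin next ih => simp only [expect]; linarith [ih true, ih false]
  | query S next ih =>
    exact Finset.sum_le_sum fun i _ => mul_le_mul_of_nonneg_left (ih i)
      (div_nonneg ENNReal.toReal_nonneg (weight_nonneg D S))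

theorem expect_add (A : CondAlg N β) (φ ψ : β → ℝ) :
    A.expect D (fun b => φ b + ψ b) = A.expect D φ + A.expect D ψ := by
  induction A with
  | ret b => rfl
  | coin next ih => simp only [expect, ih]; ring
  | query S next ih => simp only [expect, ih, mul_add, Finset.sum_add_distrib]

theorem expect_const_mul (A : CondAlg N β) (c : ℝ) (φ : β → ℝ) :
    A.expect D (fun b => c * φ b) = c * A.expect D φ := by
  induction A with
  | ret b => rfl
  | coin next ih => simp only [expect, ih]; ring
  | query S next ih =>
    simp only [expect, ih, Finset.mul_sum]
    exact Finset.sum_congr rfl fun _ _ => by ring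

theorem expect_zero (A : CondAlg N β) : A.expect D (fun _ => 0) = 0 := by
  simpa using expect_const_mul D A 0 fun _ => 0

theorem expect_nonneg (A : CondAlg N β) {φ : β → ℝ} (h : ∀ b, 0 ≤ φ b) : 0 ≤ A.expect D φ :=
  (expect_zero D A).symm.le.trans (expect_mono D A h)

theorem expect_sum {ι : Type} (s : Finset ι) (A : CondAlg N β) (φ : ι → β → ℝ) :
    A.expect D (fun b => ∑ j ∈ s, φ j b) = ∑ j ∈ s, A.expect D (φ j) := by
  classical
  induction s using Finset.induction_on with
  | empty => simpa using expect_zero D A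
  | insert a s ha ih => simp only [Finset.sum_insert ha, expect_add, ih]

theorem expect_one_le (A : CondAlg N β) : A.expect D (fun _ => 1) ≤ 1 := by
  induction A with
  | ret b => exact le_rfl
  | coin next ih => simp only [expect]; linarith [ih true, ih false]
  | query S next ih =>
    calc _ ≤ ∑ i ∈ S, (D i).toReal / weight D S * 1 :=
          Finset.sum_le_sum fun i _ => mul_le_mul_of_nonneg_left (ih i)
            (div_nonneg ENNReal.toReal_nonneg (weight_nonneg D S))
      _ = weight D S / weight D S := by simp only [mul_one, ← Finset.sum_div, weight]
      _ ≤ 1 := div_self_le_one _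

theorem expect_const_le (A : CondAlg N β) {c : ℝ} (hc : 0 ≤ c) : A.expect D (fun _ => c) ≤ c := by
  simpa using (expect_const_mul D A c fun _ => 1).le.trans
    (mul_le_mul_of_nonneg_left (expect_one_le D A) hc)

open Classical in
/-- The probability that the run does not fail and its output lies in `T`. -/
noncomputable def prob (A : CondAlg N β) (T : Set β) : ℝ :=
  A.expect D fun b => if b ∈ T then 1 else 0

theorem prob_mono (A : CondAlg N β) {T U : Set β} (h : T ⊆ U) : A.prob D T ≤ A.prob D U := by
  refine expect_mono D A fun b => ?_
  by_cases hT : b ∈ T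
  · simp [hT, h hT]
  · simp only [hT, if_false]; split_ifs <;> norm_num

theorem prob_union_le (A : CondAlg N β) (T U : Set β) :
    A.prob D (T ∪ U) ≤ A.prob D T + A.prob D U := by
  unfold prob
  rw [← expect_add]
  refine expect_mono D A fun b => ?_
  by_cases hT : b ∈ T <;> by_cases hU : b ∈ U <;> simp [hT, hU]

theorem prob_nonneg (A : CondAlg N β) (T : Set β) : 0 ≤ A.prob D T :=
  expect_nonneg D A fun b => by split_ifs <;> norm_num

/-- If the second stage is bad with probability at most `c` unless the first one is bad, then the
probabilities of the two failures add up. -/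
theorem prob_bind_le (A : CondAlg N β) (f : β → CondAlg N γ) (T : Set β) (U : Set γ) {c : ℝ}
    (hc : 0 ≤ c) (h : ∀ b, b ∉ T → (f b).prob D U ≤ c) :
    (A.bind f).prob D U ≤ A.prob D T + c := by
  classical
  calc (A.bind f).prob D U = A.expect D fun b => (f b).prob D U := expect_bind D A f _
    _ ≤ A.expect D fun b => (if b ∈ T then 1 else 0) + c := by
        refine expect_mono D A fun b => ?_
        by_cases hb : b ∈ T
        · simp only [hb, if_true]
          refine le_trans ?_ (le_add_of_nonneg_right hc)
          exact (expect_mono D _ fun b => by split_ifs <;> norm_num).trans (expect_one_le D _)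
        · simpa [hb] using h b hb
    _ = A.prob D T + A.expect D fun _ => c := by rw [expect_add]; unfold prob; congr!
    _ ≤ _ := by gcongr; exact expect_const_le D A hc

/-- The invariant is that every element seen has positive mass, so each admissible query set has
positive weight and no probability is lost to failure. -/
theorem expect_one_of_admissibleFrom (A : CondAlg N β) :
    ∀ seen : Finset (Fin N), (∀ i ∈ seen, D i ≠ 0) → A.AdmissibleFrom seen →
      A.expect D (fun _ => 1) = 1 := by
  induction A with
  | ret b => intros; rfl
  | coin next ih =>
    intro seen hs h
    simp only [expect, ih _ seen hs (h _)]
    norm_num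
  | query S next ih =>
    intro seen hs h
    have hpos : 0 < weight D S := by
      rcases h.1 with rfl | ⟨i, hi, his⟩
      · rw [weight_univ]; exact one_pos
      · exact (ENNReal.toReal_pos (hs i his) (D.apply_ne_top i)).trans_le
          (Finset.single_le_sum (f := fun i => (D i).toReal)
            (fun _ _ => ENNReal.toReal_nonneg) hi)
    calc _ = ∑ i ∈ S, (D i).toReal / weight D S := by
          refine Finset.sum_congr rfl fun i hi => ?_
          -- An answer of mass zero would break the invariant, but its term vanishes.
          by_cases h0 : D i = 0
          · simp [h0]
          · rw [ih i (insert i seen) (by simpa [h0] using hs) (h.2 i hi), mul_one]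
      _ = weight D S / weight D S := by simp only [← Finset.sum_div, weight]
      _ = 1 := div_self hpos.ne'

/-- Transfers the real-valued calculus of `expect` to the law `run`. On a null query both sides are
zero: every numerator in `expect` vanishes, and `run` yields `none`. -/
theorem toOuterMeasure_run (A : CondAlg N β) (T : Set β) :
    (A.run D).toOuterMeasure {o | ∃ b ∈ T, o = some b} = ENNReal.ofReal (A.prob D T) := by
  classical
  have hnn (A : CondAlg N β) := prob_nonneg D A T
  induction A with
  | ret b =>
    rw [run, PMF.toOuterMeasure_pure_apply]
    by_cases hb : b ∈ T <;> simp [prob, expect, hb]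
  | coin next ih =>
    rw [run, PMF.toOuterMeasure_bind_apply, tsum_fintype]
    have : (coin next).prob D T = ((next true).prob D T + (next false).prob D T) / 2 := rfl
    simp only [Fintype.sum_bool, PMF.uniformOfFintype_apply, ih, Fintype.card_bool, this]
    rw [ENNReal.ofReal_div_of_pos two_pos, ENNReal.ofReal_add (hnn _) (hnn _), ← mul_add,
      ENNReal.div_eq_inv_mul]
    norm_num
  | query S next ih =>
    have hq : (query S next).prob D T =
      ∑ i ∈ S, (D i).toReal / weight D S * (next i).prob D T := rfl
    have hsum : ∑' a, (S : Set (Fin N)).indicator D a = ENNReal.ofReal (weight D S) := by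
      rw [ofReal_weight, tsum_fintype, Finset.sum_indicator_eq_sum_filter]
      simp
    rw [run]
    split_ifs with h
    · obtain ⟨i, hi, hiD⟩ := h
      have hpos : 0 < weight D S :=
        (ENNReal.toReal_pos ((PMF.mem_support_iff _ _).1 hiD) (D.apply_ne_top i)).trans_le
          (Finset.single_le_sum (f := fun i => (D i).toReal)
            (fun _ _ => ENNReal.toReal_nonneg) hi)
      rw [PMF.toOuterMeasure_bind_apply, tsum_fintype, hq, ENNReal.ofReal_sum_of_nonneg
        fun i _ => mul_nonneg (div_nonneg ENNReal.toReal_nonneg hpos.le) (hnn _)]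
      rw [← Finset.sum_subset (Finset.subset_univ S)
        (fun j _ hj => by rw [PMF.filter_apply]; simp [hj])]
      refine Finset.sum_congr rfl fun j hj => ?_
      rw [PMF.filter_apply, hsum, ih, ENNReal.ofReal_mul (div_nonneg ENNReal.toReal_nonneg hpos.le),
        ENNReal.ofReal_div_of_pos hpos, ENNReal.ofReal_toReal (D.apply_ne_top j),
        Set.indicator_of_mem (by exact_mod_cast hj), div_eq_mul_inv]
    · have h0 : ∀ i ∈ S, D i = 0 := fun i hi => by
        by_contra hne
        exact h ⟨i, hi, (PMF.mem_support_iff _ _).2 hne⟩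
      rw [PMF.toOuterMeasure_pure_apply, hq, Finset.sum_eq_zero fun i hi => by simp [h0 i hi]]
      simp

theorem run_none_of_admissibleFrom (A : CondAlg N β) (seen : Finset (Fin N))
    (hs : ∀ i ∈ seen, D i ≠ 0) (h : A.AdmissibleFrom seen) : A.run D none = 0 := by
  have h1 : (A.run D).toOuterMeasure {o | ∃ b ∈ Set.univ, o = some b} = 1 := by
    rw [toOuterMeasure_run]
    simp [prob, expect_one_of_admissibleFrom D A seen hs h]
  rw [PMF.toOuterMeasure_apply_eq_one_iff] at h1
  by_contra hne
  obtain ⟨b, -, hb⟩ := h1 ((PMF.mem_support_iff _ _).2 hne)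
  simp at hb

/-! ### Repeated tests and Chernoff bounds -/

/-- The number of `true` among `m` independent runs of `A`. -/
def count (A : CondAlg N Bool) : ℕ → CondAlg N ℕ
  | 0 => ret 0
  | m + 1 => A.bind fun b => (count A m).bind fun c => ret (c + b.toNat)

theorem queries_count_le (A : CondAlg N Bool) (m : ℕ) :
    (A.count m).queries ≤ m * A.queries := by
  induction m with
  | zero => simp [count, queries]
  | succ m ih =>
    refine (queries_bind_le (n := m * A.queries) fun b =>
      (queries_bind_le (n := 0) fun c => by simp [queries]).trans ?_).trans ?_
    · simpa using ih
    · rw [Nat.succ_mul, add_comm]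

/-- Independent runs multiply exponential moments, and `exp s - 1 ≤ s + s ^ 2` bounds a single
factor for either sign of `s`, so one lemma serves both tails. -/
theorem expect_exp_count_le (A : CondAlg N Bool) {s : ℝ} (hs : |s| ≤ 1) (m : ℕ) :
    (A.count m).expect D (fun c => Real.exp (s * c)) ≤
      Real.exp (m * (A.prob D {true} * (s + s ^ 2))) := by
  have hp := prob_nonneg D A {true}
  induction m with
  | zero => simp [count, expect]
  | succ m ih =>
    have hexp : Real.exp s - 1 ≤ s + s ^ 2 := by
      have := (abs_le.1 (Real.abs_exp_sub_one_sub_id_le hs)).2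
      linarith
    have hstep (b : Bool) : Real.exp (s * b.toNat) =
        1 + (Real.exp s - 1) * (if b ∈ ({true} : Set Bool) then 1 else 0) := by
      cases b <;> simp
    have hA : A.expect D (fun b => Real.exp (s * b.toNat)) ≤
        Real.exp (A.prob D {true} * (s + s ^ 2)) := by
      calc _ = A.expect D (fun _ => 1) + (Real.exp s - 1) * A.prob D {true} := by
            simp only [hstep]
            rw [expect_add, expect_const_mul]
            unfold prob
            congr!
        _ ≤ A.prob D {true} * (s + s ^ 2) + 1 := by
            nlinarith [expect_one_le D A, mul_le_mul_of_nonneg_left hexp hp]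
        _ ≤ _ := Real.add_one_le_exp _
    calc _ = (A.count m).expect D (fun c => Real.exp (s * c)) *
          A.expect D (fun b => Real.exp (s * b.toNat)) := by
          simp only [count, expect_bind, expect]
          rw [← expect_const_mul]
          congr 1
          ext b
          rw [mul_comm, ← expect_const_mul]
          congr 1
          ext c
          rw [← Real.exp_add]
          congr 1
          push_cast
          ring
      _ ≤ Real.exp (m * (A.prob D {true} * (s + s ^ 2))) *
          Real.exp (A.prob D {true} * (s + s ^ 2)) := by
          gcongr
          exact expect_nonneg D A fun _ => (Real.exp_pos _).le
      _ = _ := by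
          rw [← Real.exp_add]
          congr 1
          push_cast
          ring

/-- Markov's inequality for the exponential moment of the count. -/
theorem prob_count_le (A : CondAlg N Bool) {s : ℝ} (hs : |s| ≤ 1) (m : ℕ) (a : ℝ) (T : Set ℕ)
    (hT : ∀ c ∈ T, a ≤ s * c) :
    (A.count m).prob D T ≤ Real.exp (m * (A.prob D {true} * (s + s ^ 2)) - a) := by
  classical
  calc (A.count m).prob D T
      ≤ (A.count m).expect D (fun c => Real.exp (-a) * Real.exp (s * c)) := by
        refine expect_mono D _ fun c => ?_
        rw [← Real.exp_add]
        by_cases hc : c ∈ T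
        · simpa [hc] using hT c hc
        · simpa [hc] using (Real.exp_pos _).le
    _ ≤ Real.exp (-a) * Real.exp (m * (A.prob D {true} * (s + s ^ 2))) := by
        rw [expect_const_mul]
        gcongr
        exact expect_exp_count_le D A hs m
    _ = _ := by rw [← Real.exp_add]; congr 1; ring

/-- The counts out of `m` that misrepresent a success probability `q`: those that are off by more
than a factor `1 ± η` if `q ≥ τ`, and those that reach `2 τ m` if `q < τ`. -/
def misleading (q τ η : ℝ) (m : ℕ) : Set ℕ :=
  {c | if τ ≤ q then (c : ℝ) < (1 - η) * (m * q) ∨ (1 + η) * (m * q) < c else 2 * (m * τ) ≤ c}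

theorem prob_misleading_le (A : CondAlg N Bool) {τ η : ℝ} (hτ : 0 ≤ τ) (hη : 0 ≤ η) (hη1 : η ≤ 1)
    (m : ℕ) :
    (A.count m).prob D (misleading (A.prob D {true}) τ η m) ≤
      2 * Real.exp (-(m * τ * η ^ 2 / 4)) := by
  set q := A.prob D {true} with hq
  have hm : (0 : ℝ) ≤ m := m.cast_nonneg
  have hmτ : 0 ≤ m * τ := mul_nonneg hm hτ
  by_cases h : τ ≤ q
  · have hmq : m * τ ≤ m * q := mul_le_mul_of_nonneg_left h hm
    have hsub : misleading q τ η m ⊆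
        {c : ℕ | (c : ℝ) < (1 - η) * (m * q)} ∪ {c : ℕ | (1 + η) * (m * q) < c} := by
      intro c hc
      simpa [misleading, h] using hc
    -- The choice `s = ±η / 2` minimizes `s ^ 2 - |s| * η`, which gives the exponent `-(m * q * η ^
    -- 2 / 4)` in both tails.
    have h1 := prob_count_le D A (s := -(η / 2)) (by rw [abs_neg, abs_of_nonneg] <;> linarith) m
      (-(η / 2) * ((1 - η) * (m * q))) {c : ℕ | (c : ℝ) < (1 - η) * (m * q)}
      (fun c (hc : (c : ℝ) < _) => by nlinarith)
    have h2 := prob_count_le D A (s := η / 2) (by rw [abs_of_nonneg] <;> linarith) m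
      (η / 2 * ((1 + η) * (m * q))) {c : ℕ | (1 + η) * (m * q) < (c : ℝ)}
      (fun c (hc : _ < (c : ℝ)) => by nlinarith)
    have hle : -(m * q * η ^ 2 / 4) ≤ -(m * τ * η ^ 2 / 4) := by
      nlinarith [mul_le_mul_of_nonneg_right hmq (sq_nonneg η)]
    have e1 : m * (q * (-(η / 2) + (-(η / 2)) ^ 2)) - -(η / 2) * ((1 - η) * (m * q)) =
      -(m * q * η ^ 2 / 4) := by ring
    have e2 : m * (q * (η / 2 + (η / 2) ^ 2)) - η / 2 * ((1 + η) * (m * q)) =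
      -(m * q * η ^ 2 / 4) := by ring
    rw [← hq, e1] at h1
    rw [← hq, e2] at h2
    have := Real.exp_le_exp.2 hle
    linarith [(prob_mono D (A.count m) hsub).trans (prob_union_le D _ _ _)]
  · have h1 := prob_count_le D A (s := 1 / 2) (by norm_num [abs_of_pos]) m (m * τ)
      (misleading q τ η m) (fun c hc => by
        simp only [misleading, h, if_false, Set.mem_ofPred_eq] at hc; linarith)
    rw [← hq] at h1
    have hmq : m * q ≤ m * τ := mul_le_mul_of_nonneg_left (not_le.1 h).le hm
    have hη2 : η ^ 2 ≤ 1 := pow_le_one₀ hη hη1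
    have hle : m * (q * (1 / 2 + (1 / 2) ^ 2)) - m * τ ≤ -(m * τ * η ^ 2 / 4) := by
      nlinarith [mul_le_mul_of_nonneg_left hη2 hmτ]
    linarith [Real.exp_le_exp.2 hle, Real.exp_pos (-(m * τ * η ^ 2 / 4))]

end Expectation

end CondAlg

/-! ### Random subsets from fair coins -/

namespace CondAlg

variable {N : ℕ}

/-- Refresh by fair coins which of the elements of a list belong to a given set. -/
def coinSubset : List (Fin N) → CondAlg N (Finset (Fin N))
  | [] => ret ∅
  | a :: l => coin fun b => (coinSubset l).bind fun R => ret (if b then insert a R else R.erase a)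

/-- A random subset of the domain that contains every element with probability `2 ^ (-k)`,
independently of the others. -/
def randomSubset : ℕ → CondAlg N (Finset (Fin N))
  | 0 => ret Finset.univ
  | k + 1 => (coinSubset (List.finRange N)).bind fun U =>
      (randomSubset k).bind fun R => ret (U ∩ R)

theorem queries_coinSubset (l : List (Fin N)) : (coinSubset l).queries = 0 := by
  induction l with
  | nil => rfl
  | cons a l ih =>
    simp only [coinSubset, queries]
    refine Nat.le_zero.1 (Finset.sup_le fun b _ => ?_)
    exact (queries_bind_le (n := 0) fun R => by simp [queries]).trans (by simp [ih])

theorem queries_randomSubset (k : ℕ) : (randomSubset k : CondAlg N _).queries = 0 := by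
  induction k with
  | zero => rfl
  | succ k ih =>
    refine Nat.le_zero.1 ((queries_bind_le (n := 0) fun U => ?_).trans
      (by simp [queries_coinSubset]))
    exact (queries_bind_le (n := 0) fun R => by simp [queries]).trans (by simp [ih])

theorem safe_coinSubset (l : List (Fin N)) (seen : Finset (Fin N)) :
    (coinSubset l).Safe seen fun s _ => s = seen := by
  induction l with
  | nil => rfl
  | cons a l ih => exact fun b => ih.bind fun s R h => h

theorem safe_randomSubset (k : ℕ) (seen : Finset (Fin N)) :
    (randomSubset k).Safe seen fun s _ => s = seen := by
  induction k with
  | zero => rfl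
  | succ k ih =>
    refine (safe_coinSubset _ seen).bind fun s U h => ?_
    subst h
    exact ih.bind fun s R h => h

variable (D : PMF (Fin N))

/-- Forgetting the coin of `j` and inserting `j` by force has the same effect as conditioning on `j
∈ R`. Repetitions in `l` are harmless, since the coin at the head overrides the later ones. -/
theorem expect_coinSubset_mem {l : List (Fin N)} {j : Fin N} (hj : j ∈ l)
    (f : Finset (Fin N) → ℝ) :
    (coinSubset l).expect D (fun R => if j ∈ R then f R else 0) =
      1 / 2 * (coinSubset l).expect D (fun R => f (insert j R)) := by
  induction l generalizing f with
  | nil => simp at hj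
  | cons a l ih =>
    simp only [coinSubset, expect, expect_bind, if_true, Bool.false_eq_true, if_false]
    by_cases hja : j = a
    · subst hja
      simp only [Finset.mem_insert_self, if_true, Finset.notMem_erase, if_false, expect_zero,
        Finset.insert_idem]
      have (R : Finset (Fin N)) : insert j (R.erase j) = insert j R := by
        ext x; by_cases hx : x = j <;> simp [hx]
      simp only [this]
      ring
    · have h1 (R : Finset (Fin N)) : j ∈ insert a R ↔ j ∈ R := by simp [hja]
      have h2 (R : Finset (Fin N)) : j ∈ R.erase a ↔ j ∈ R := by simp [hja]
      have h3 (R : Finset (Fin N)) : insert j (R.erase a) = (insert j R).erase a :=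
        (Finset.erase_insert_of_ne hja).symm
      have hl : j ∈ l := (List.mem_cons.1 hj).resolve_left hja
      simp only [h1, h2, h3, Finset.insert_comm j a]
      rw [ih hl fun R => f (insert a R), ih hl fun R => f (R.erase a)]
      ring

theorem expect_randomSubset_mem (k : ℕ) (j : Fin N) (f : Finset (Fin N) → ℝ) :
    (randomSubset k).expect D (fun R => if j ∈ R then f R else 0) =
      (1 / 2) ^ k * (randomSubset k).expect D (fun R => f (insert j R)) := by
  induction k generalizing f with
  | zero => simp [randomSubset, expect]
  | succ k ih =>
    simp only [randomSubset, expect_bind, expect]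
    have h1 (U : Finset (Fin N)) :
        (randomSubset k).expect D (fun R => if j ∈ U ∩ R then f (U ∩ R) else 0) =
          if j ∈ U then (1 / 2) ^ k *
            (randomSubset k).expect D (fun R => f (U ∩ insert j R)) else 0 := by
      by_cases hU : j ∈ U
      · simpa [hU] using ih fun R => f (U ∩ R)
      · simp [hU, expect_zero]
    simp only [h1]
    rw [expect_coinSubset_mem D (List.mem_finRange j), expect_const_mul]
    have h2 (U R : Finset (Fin N)) : insert j U ∩ insert j R = insert j (U ∩ R) := by
      ext x; simp only [Finset.mem_inter, Finset.mem_insert]; tauto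
    simp only [h2]
    ring

theorem expect_one_randomSubset (k : ℕ) :
    (randomSubset k).expect D (fun _ => 1) = 1 :=
  expect_one_of_admissibleFrom D _ ∅ (by simp) (safe_randomSubset k ∅).admissibleFrom

theorem expect_weight_randomSubset (k : ℕ) :
    (randomSubset k).expect D (weight D) = (1 / 2) ^ k := by
  have h : weight D = fun R => ∑ j, (D j).toReal * (if j ∈ R then 1 else 0) := by
    ext R; simp [weight]
  rw [h, expect_sum]
  simp only [expect_const_mul, expect_randomSubset_mem D k _ fun _ => 1, expect_one_randomSubset]
  rw [← Finset.sum_mul]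
  have := weight_univ D
  unfold weight at this
  rw [this, one_mul, mul_one]

/-! ### The two tests and the identity that links them -/

/-- Draw `j` from the distribution and test whether `i` is drawn from a random set together with
`i` and `j`. -/
def hitTest (k : ℕ) (i : Fin N) : CondAlg N Bool :=
  query Finset.univ fun j => (randomSubset k).bind fun R =>
    query (insert i (insert j R)) fun x => ret (decide (x = i))

/-- Test whether an element drawn from a random set together with `i` belongs to the random set. -/
def missTest (k : ℕ) (i : Fin N) : CondAlg N Bool :=
  (randomSubset k).bind fun R => query (insert i R) fun x => ret (decide (x ∈ R))

/-- The probability that `hitTest` succeeds. -/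
noncomputable def hitProb (k : ℕ) (i : Fin N) : ℝ := (hitTest k i).prob D {true}

/-- The probability that `missTest` succeeds. -/
noncomputable def missProb (k : ℕ) (i : Fin N) : ℝ := (missTest k i).prob D {true}

theorem hitProb_eq (k : ℕ) (i : Fin N) :
    hitProb D k i = ∑ j, (D j).toReal * (randomSubset k).expect D
      (fun R => (D i).toReal / weight D (insert i (insert j R))) := by
  simp [hitProb, prob, hitTest, expect, expect_bind, weight_univ]

theorem missProb_eq (k : ℕ) (i : Fin N) :
    missProb D k i =
      (randomSubset k).expect D (fun R => weight D R / weight D (insert i R)) := by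
  have (R : Finset (Fin N)) : weight D R / weight D (insert i R) =
      ∑ x ∈ insert i R, if x ∈ R then (D x).toReal / weight D (insert i R) else 0 := by
    rw [← Finset.sum_filter, ← Finset.sum_div]
    congr 1
    unfold weight
    congr 1
    ext x
    simp only [Finset.mem_filter, Finset.mem_insert]
    tauto
  simp [missProb, prob, missTest, expect, expect_bind, this]

/-- The reversibility relation behind the evaluation. -/
theorem half_pow_mul_hitProb (k : ℕ) (i : Fin N) :
    (1 / 2) ^ k * hitProb D k i = (D i).toReal * missProb D k i := by
  have h (R : Finset (Fin N)) : weight D R / weight D (insert i R) =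
      ∑ j, if j ∈ R then (D j).toReal / weight D (insert i R) else 0 := by
    simp [← Finset.sum_div, weight]
  rw [hitProb_eq, missProb_eq]
  simp only [h]
  rw [expect_sum, Finset.mul_sum, Finset.mul_sum]
  refine Finset.sum_congr rfl fun j _ => ?_
  -- Conditioning on `j ∈ R` produces the factor `2^(-k)` and turns `R ∪ {i}` into the query set of
  -- the hit test.
  rw [expect_randomSubset_mem D k j fun R => (D j).toReal / weight D (insert i R)]
  simp only [div_eq_mul_inv, expect_const_mul]
  ring

/-- Convexity of `1 / w`: the query set has expected weight at most `3 * D(i)` for every `j` no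
heavier than `i`, so it returns `i` with probability at least `1 / 3`. -/
theorem le_hitProb {k : ℕ} {i : Fin N} (hi : 0 < (D i).toReal)
    (hk : (1 / 2) ^ k ≤ (D i).toReal) :
    weight D {j | D j ≤ D i} / 3 ≤ hitProb D k i := by
  set d := (D i).toReal with hd
  have hR (j : Fin N) (hj : D j ≤ D i) (R : Finset (Fin N)) :
      4 / 9 + (-1 / (9 * d)) * weight D R ≤ d / weight D (insert i (insert j R)) := by
    have hjd : (D j).toReal ≤ d := ENNReal.toReal_mono (D.apply_ne_top i) hj
    have hins (a : Fin N) (T : Finset (Fin N)) :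
        weight D (insert a T) ≤ (D a).toReal + weight D T := by
      by_cases ha : a ∈ T
      · simp [ha]
      · simp [weight, Finset.sum_insert ha]
    have hw : weight D (insert i (insert j R)) ≤ 2 * d + weight D R := by
      linarith [hins i (insert j R), hins j R]
    have hpos : 0 < weight D (insert i (insert j R)) :=
      hi.trans_le (Finset.single_le_sum (f := fun i => (D i).toReal)
        (fun _ _ => ENNReal.toReal_nonneg) (Finset.mem_insert_self _ _))
    set w := weight D (insert i (insert j R))
    have e : 4 / 9 + (-1 / (9 * d)) * weight D R = (4 * d - weight D R) / (9 * d) := by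
      field_simp
      ring
    rw [e, div_le_div_iff₀ (by positivity) hpos]
    -- The tangent at `w = 3 * d` gives `d / w ≥ 2 / 3 - w / (9 * d)`; then `w ≤ 2 * d + weight D R`
    -- is inserted.
    nlinarith [sq_nonneg (w - 3 * d), mul_le_mul_of_nonneg_left hw hpos.le]
  have hE (j : Fin N) (hj : D j ≤ D i) :
      1 / 3 ≤ (randomSubset k).expect D (fun R => d / weight D (insert i (insert j R))) := by
    refine le_trans ?_ (expect_mono D _ (hR j hj))
    rw [expect_add, expect_const_mul, expect_weight_randomSubset]
    have h1 := expect_const_mul D (randomSubset k : CondAlg N _) (4 / 9) fun _ => 1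
    rw [expect_one_randomSubset, mul_one] at h1
    rw [h1]
    have h2 : 1 / (9 * d) * (1 / 2) ^ k ≤ 1 / 9 := by
      calc _ ≤ 1 / (9 * d) * d := by gcongr
        _ = 1 / 9 := by field_simp
    have h3 : -1 / (9 * d) = -(1 / (9 * d)) := by ring
    rw [h3]
    linarith
  rw [hitProb_eq]
  calc _ = ∑ j with D j ≤ D i, (D j).toReal * (1 / 3) := by
        rw [← Finset.sum_mul, weight]; ring
    _ ≤ ∑ j with D j ≤ D i, (D j).toReal * (randomSubset k).expect D
          (fun R => d / weight D (insert i (insert j R))) := by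
        refine Finset.sum_le_sum fun j hj => ?_
        exact mul_le_mul_of_nonneg_left (hE j (Finset.mem_filter.1 hj).2) ENNReal.toReal_nonneg
    _ ≤ _ := by
        refine Finset.sum_le_sum_of_subset_of_nonneg (Finset.subset_univ _) fun j _ _ => ?_
        exact mul_nonneg ENNReal.toReal_nonneg (expect_nonneg D _ fun R =>
          div_nonneg hi.le (weight_nonneg D _))

theorem queries_hitTest_le (k : ℕ) (i : Fin N) : (hitTest k i).queries ≤ 2 := by
  have : (Finset.univ.sup fun j : Fin N => ((randomSubset k).bind fun R =>
      query (insert i (insert j R)) fun x => ret (decide (x = i))).queries) ≤ 1 := by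
    refine Finset.sup_le fun j _ => (queries_bind_le (n := 1) fun R => ?_).trans
      (by simp [queries_randomSubset])
    simp [queries]
  simp only [hitTest, queries]
  lia

theorem queries_missTest_le (k : ℕ) (i : Fin N) : (missTest k i).queries ≤ 1 :=
  (queries_bind_le (n := 1) fun R => by simp [queries]).trans (by simp [queries_randomSubset])

theorem safe_hitTest (k : ℕ) (i : Fin N) (seen : Finset (Fin N)) :
    (hitTest k i).Safe seen fun s b => seen ⊆ s ∧ (b = true → i ∈ s) := by
  refine ⟨Or.inl rfl, fun j _ => (safe_randomSubset k _).bind fun s R hs => ?_⟩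
  subst hs
  refine ⟨Or.inr ⟨j, by simp, by simp⟩, fun x _ => ⟨fun y hy => by simp [hy], fun h => ?_⟩⟩
  simp [of_decide_eq_true h]

theorem safe_missTest (k : ℕ) {i : Fin N} {seen : Finset (Fin N)} (hi : i ∈ seen) :
    (missTest k i).Safe seen fun s _ => seen ⊆ s := by
  refine (safe_randomSubset k _).bind fun s R hs => ?_
  subst hs
  exact ⟨Or.inr ⟨i, by simp, hi⟩, fun x _ => Finset.subset_insert _ _⟩

/-- A success of the hit test is an answer `i` of the oracle, which is what permits the queries of
the miss test afterwards. -/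
theorem safe_count_hitTest (k : ℕ) (i : Fin N) (m : ℕ) (seen : Finset (Fin N)) :
    ((hitTest k i).count m).Safe seen fun s c => seen ⊆ s ∧ (0 < c → i ∈ s) := by
  induction m generalizing seen with
  | zero => exact ⟨subset_rfl, fun h => absurd h (lt_irrefl 0)⟩
  | succ m ih =>
    refine (safe_hitTest k i seen).bind fun s b hb => (ih s).bind fun s' c hc => ?_
    refine ⟨hb.1.trans hc.1, fun h => ?_⟩
    cases b with
    | true => exact hc.1 (hb.2 rfl)
    | false => exact hc.2 (by simpa using h)

theorem safe_count_missTest (k : ℕ) {i : Fin N} (m : ℕ) {seen : Finset (Fin N)} (hi : i ∈ seen) :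
    ((missTest k i).count m).Safe seen fun _ _ => True := by
  induction m generalizing seen with
  | zero => trivial
  | succ m ih =>
    refine (safe_missTest k hi).bind fun s b hb => (ih (hb hi)).bind fun _ _ _ => ?_
    trivial

/-! ### The search through the scales -/

open Classical in
/-- Go through the scales `k, k + 1, …, k + n - 1` until both tests succeed at least `t` times out
of `m`, and then answer with the ratio of the two counts. -/
noncomputable def evalFrom (i : Fin N) (t : ℝ) (m : ℕ) : ℕ → ℕ → CondAlg N EvalAnswer
  | _, 0 => ret .unknown
  | k, n + 1 =>
    ((hitTest k i).count m).bind fun g =>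
      -- `0 < g` ensures that `i` has been returned, whatever `t` is; admissibility thus needs no
      -- condition on the parameters.
      if 0 < g ∧ t ≤ g then
        ((missTest k i).count m).bind fun b =>
          if t ≤ b then ret (.value (Set.projIcc 0 1 zero_le_one ((1 / 2) ^ k * g / b)))
          else evalFrom i t m (k + 1) n
      else evalFrom i t m (k + 1) n

theorem safe_evalFrom (i : Fin N) (t : ℝ) (m n k : ℕ) (seen : Finset (Fin N)) :
    (evalFrom i t m k n).Safe seen fun _ _ => True := by
  induction n generalizing k seen with
  | zero => trivial
  | succ n ih =>
    refine (safe_count_hitTest k i m seen).bind fun s g hg => ?_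
    split_ifs with h
    · refine (safe_count_missTest k m (hg.2 h.1)).bind fun s' b _ => ?_
      split_ifs
      · trivial
      · exact ih _ _
    · exact ih _ _

theorem queries_evalFrom_le (i : Fin N) (t : ℝ) (m n k : ℕ) :
    (evalFrom i t m k n).queries ≤ 3 * m * n := by
  induction n generalizing k with
  | zero => simp [evalFrom, queries]
  | succ n ih =>
    have hit : ((hitTest k i).count m).queries ≤ m * 2 :=
      (queries_count_le _ m).trans (Nat.mul_le_mul_left m (queries_hitTest_le k i))
    have miss : ((missTest k i).count m).queries ≤ m * 1 :=
      (queries_count_le _ m).trans (Nat.mul_le_mul_left m (queries_missTest_le k i))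
    refine (queries_bind_le (n := m + 3 * m * n) fun g => ?_).trans (by lia)
    split_ifs
    · refine (queries_bind_le (n := 3 * m * n) fun b => ?_).trans (by lia)
      split_ifs
      · simp [queries]
      · exact ih _
    · exact (ih _).trans (by lia)

/-- The numerical answers that are accurate up to a factor `1 ± ε`. -/
def accurateAnswers (ε : ℝ) (i : Fin N) : Set EvalAnswer :=
  {v | ∃ a : Set.Icc (0 : ℝ) 1, v = .value a ∧
    (1 - ε) * (D i).toReal ≤ (a : ℝ) ∧ (a : ℝ) ≤ (1 + ε) * (D i).toReal}

/-- Since `p * G = d * B` exactly, only the two sampling errors matter, and `(1 + ε / 4) / (1 - ε /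
4)` and its inverse lie within `1 ± ε`. -/
theorem ratio_accurate {ε d p G B g b M : ℝ} (hε : 0 < ε) (hε1 : ε < 1) (hd : 0 ≤ d) (hp : 0 < p)
    (hB : 0 < B) (hM : 0 < M) (h : p * G = d * B)
    (hg1 : (1 - ε / 4) * (M * G) ≤ g) (hg2 : g ≤ (1 + ε / 4) * (M * G))
    (hb1 : (1 - ε / 4) * (M * B) ≤ b) (hb2 : b ≤ (1 + ε / 4) * (M * B)) :
    (1 - ε) * d ≤ p * g / b ∧ p * g / b ≤ (1 + ε) * d := by
  have hMB : 0 < M * B := mul_pos hM hB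
  have hb : 0 < b := lt_of_lt_of_le (mul_pos (by linarith) hMB) hb1
  have hpg1 : (1 - ε / 4) * (M * B) * d ≤ p * g := by
    calc _ = p * ((1 - ε / 4) * (M * G)) := by linear_combination -(1 - ε / 4) * M * h
      _ ≤ _ := by gcongr
  have hpg2 : p * g ≤ (1 + ε / 4) * (M * B) * d := by
    calc p * g ≤ p * ((1 + ε / 4) * (M * G)) := by gcongr
      _ = _ := by linear_combination (1 + ε / 4) * M * h
  have hMBd : 0 ≤ M * B * d := mul_nonneg hMB.le hd
  constructor
  · rw [le_div_iff₀ hb]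
    calc (1 - ε) * d * b ≤ (1 - ε) * d * ((1 + ε / 4) * (M * B)) :=
          mul_le_mul_of_nonneg_left hb2 (mul_nonneg (by linarith) hd)
      _ = (1 - ε) * (1 + ε / 4) * (M * B * d) := by ring
      _ ≤ (1 - ε / 4) * (M * B * d) := by gcongr; nlinarith
      _ ≤ p * g := by linarith
  · rw [div_le_iff₀ hb]
    calc p * g ≤ (1 + ε / 4) * (M * B * d) := by linarith
      _ ≤ (1 + ε) * (1 - ε / 4) * (M * B * d) := by gcongr; nlinarith
      _ = (1 + ε) * d * ((1 - ε / 4) * (M * B)) := by ring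
      _ ≤ _ := mul_le_mul_of_nonneg_left hb1 (mul_nonneg (by linarith) hd)

/-! ### Error analysis of the search -/

section Correctness

variable {D} {i : Fin N} {ε : ℝ} {m : ℕ}

/-- The failure probability of the estimation of one success probability from `m` runs. -/
noncomputable def countError (ε : ℝ) (m : ℕ) : ℝ := 2 * Real.exp (-(m * ε ^ 3 / 1536))

theorem countError_nonneg : 0 ≤ countError ε m := by unfold countError; positivity

theorem prob_misleading_le_countError (hε : 0 < ε) (hε1 : ε < 1) (A : CondAlg N Bool) :
    (A.count m).prob D (misleading (A.prob D {true}) (ε / 24) (ε / 4) m) ≤ countError ε m := by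
  refine (prob_misleading_le D A (by positivity) (by positivity) (by linarith) m).trans_eq ?_
  unfold countError
  congr 3
  -- `1536 = 24 * 4 ^ 2 * 4`, from `τ = ε / 24`, `η = ε / 4` and the `4` of the Chernoff exponent.
  ring

theorem bounds_of_not_misleading {q τ η : ℝ} {c : ℕ} (hc : c ∉ misleading q τ η m)
    (ht : 2 * (m * τ) ≤ c) :
    τ ≤ q ∧ (1 - η) * (m * q) ≤ c ∧ c ≤ (1 + η) * (m * q) := by
  by_cases h : τ ≤ q
  · refine ⟨h, ?_⟩
    simpa [misleading, h] using hc
  · exact absurd (by simpa [misleading, h] using ht) hc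

/-- Here `q ≥ 4 * τ` with `τ = ε / 24`, so even after the loss of a factor `1 - ε / 4` the count
passes the threshold `2 * m * τ`. -/
theorem le_of_not_misleading {q : ℝ} {c : ℕ} (hε : 0 < ε) (hε1 : ε < 1) (hq : ε / 6 ≤ q)
    (hc : c ∉ misleading q (ε / 24) (ε / 4) m) : 2 * (m * (ε / 24)) ≤ c := by
  have h : ε / 24 ≤ q := by linarith
  have h1 : (1 - ε / 4) * (m * q) ≤ c := by
    have : ¬ ((c : ℝ) < (1 - ε / 4) * (m * q) ∨ (1 + ε / 4) * (m * q) < c) := by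
      simpa [misleading, h] using hc
    exact not_lt.1 fun h => this (Or.inl h)
  have hm : (0 : ℝ) ≤ m := m.cast_nonneg
  refine le_trans ?_ h1
  have h2 : ε / 12 ≤ (1 - ε / 4) * q := by nlinarith
  nlinarith [mul_le_mul_of_nonneg_left h2 hm]

/-- Clamping to `[0, 1]` keeps the estimate accurate because `D(i)` itself lies in that interval. -/
theorem value_mem_accurateAnswers {x : ℝ} (hx0 : 0 ≤ x)
    (hx : (1 - ε) * (D i).toReal ≤ x ∧ x ≤ (1 + ε) * (D i).toReal) :
    EvalAnswer.value (Set.projIcc 0 1 zero_le_one x) ∈ accurateAnswers D ε i := by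
  refine ⟨_, rfl, ?_⟩
  have hd : (D i).toReal ≤ 1 := ENNReal.toReal_mono ENNReal.one_ne_top (D.coe_le_one i)
  have hd0 : 0 ≤ (D i).toReal := ENNReal.toReal_nonneg
  rw [Set.coe_projIcc]
  constructor
  · exact le_max_of_le_right (le_min (by nlinarith) hx.1)
  · exact max_le (by nlinarith) ((min_le_right _ _).trans hx.2)

/-- Union bound over two counts per scale; no scale has to be good, since an answer is given only
when both counts pass the threshold. -/
theorem prob_inaccurate_evalFrom_le (hε : 0 < ε) (hε1 : ε < 1) (hm : 0 < m) (n k : ℕ) :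
    (evalFrom i (2 * (m * (ε / 24))) m k n).prob D ({.unknown} ∪ accurateAnswers D ε i)ᶜ ≤
      2 * n * countError ε m := by
  have he : 0 ≤ countError ε m := countError_nonneg
  induction n generalizing k with
  | zero => simp [evalFrom, prob, expect]
  | succ n ih =>
    have hn : 0 ≤ 2 * n * countError ε m := by positivity
    refine (prob_bind_le D _ _ (misleading (hitProb D k i) (ε / 24) (ε / 4) m) _
      (c := countError ε m + 2 * n * countError ε m) (by positivity) fun g hg => ?_).trans ?_
    · split_ifs with h
      · refine (prob_bind_le D _ _ (misleading (missProb D k i) (ε / 24) (ε / 4) m) _ hn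
          fun b hb => ?_).trans (by gcongr; exact prob_misleading_le_countError hε hε1 _)
        split_ifs with h'
        · obtain ⟨-, hg1, hg2⟩ := bounds_of_not_misleading hg h.2
          obtain ⟨hB, hb1, hb2⟩ := bounds_of_not_misleading hb h'
          have := value_mem_accurateAnswers (i := i) (D := D) (x := (1 / 2) ^ k * g / b)
            (by positivity)
            (ratio_accurate hε hε1 ENNReal.toReal_nonneg (by positivity) (by linarith)
              (Nat.cast_pos.2 hm) (half_pow_mul_hitProb D k i) hg1 hg2 hb1 hb2)
          simp only [prob, expect, Set.mem_compl_iff, Set.mem_union, this, or_true,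
            not_true_eq_false, if_false]
          exact hn
        · exact ih _
      · exact (ih _).trans (by linarith)
    · have := prob_misleading_le_countError (D := D) (m := m) hε hε1 (hitTest k i)
      push_cast
      unfold hitProb
      linarith

/-- Only the two counts at the good scale `k` matter: earlier scales either give a number or pass
the run on, and at `k` both counts pass the threshold unless misleading. Hence no factor `n`. -/
theorem prob_unknown_evalFrom_le (hε : 0 < ε) (hε1 : ε < 1) (hm : 0 < m) {k : ℕ}
    (hhit : ε / 6 ≤ hitProb D k i) (hmiss : ε / 6 ≤ missProb D k i) (n j : ℕ) (hj : j ≤ k)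
    (hk : k < j + n) :
    (evalFrom i (2 * (m * (ε / 24))) m j n).prob D {.unknown} ≤ 2 * countError ε m := by
  have he : 0 ≤ countError ε m := countError_nonneg
  have hmR : (0 : ℝ) < m := Nat.cast_pos.2 hm
  induction n generalizing j with
  | zero => lia
  | succ n ih =>
    rcases hj.eq_or_lt with rfl | hlt
    · refine (prob_bind_le D _ _ (misleading (hitProb D j i) (ε / 24) (ε / 4) m) _
        (c := countError ε m) he fun g hg => ?_).trans ?_
      · have ht := le_of_not_misleading hε hε1 hhit hg
        have hg0 : 0 < g := by
          have : (0 : ℝ) < g := lt_of_lt_of_le (by positivity) ht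
          exact_mod_cast this
        rw [if_pos ⟨hg0, ht⟩]
        refine (prob_bind_le D _ _ (misleading (missProb D j i) (ε / 24) (ε / 4) m) _ le_rfl
          fun b hb => ?_).trans
            ((add_zero _).trans_le (prob_misleading_le_countError hε hε1 _))
        rw [if_pos (le_of_not_misleading hε hε1 hmiss hb)]
        simp [prob, expect]
      · have := prob_misleading_le_countError (D := D) (m := m) hε hε1 (hitTest j i)
        unfold hitProb
        linarith
    · have hrec := ih (j + 1) hlt (by lia)
      refine (prob_bind_le D _ _ ∅ _ (c := 2 * countError ε m) (by positivity)
        fun g _ => ?_).trans (by simp [prob, expect_zero])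
      split_ifs
      · refine (prob_bind_le D _ _ ∅ _ (c := 2 * countError ε m) (by positivity)
          fun b _ => ?_).trans (by simp [prob, expect_zero])
        split_ifs
        · simp only [prob, expect, Set.mem_singleton_iff, reduceCtorEq, if_false]
          positivity
        · exact hrec
      · exact hrec

theorem prob_add_prob_compl {β : Type} (A : CondAlg N β) (hA : A.Admissible) (T : Set β) :
    A.prob D T + A.prob D Tᶜ = 1 := by
  classical
  rw [← expect_one_of_admissibleFrom D A ∅ (by simp) hA, prob, prob, ← expect_add]
  congr 1
  ext b
  by_cases hb : b ∈ T <;> simp [hb]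

end Correctness

end CondAlg

/-! ### The exceptional set and the choice of parameters -/

namespace CondAlg

open Classical in
/-- The elements whose lower level set has weight less than `ε`. -/
noncomputable def lightElements {N : ℕ} (D : PMF (Fin N)) (ε : ℝ) : Finset (Fin N) :=
  {i | weight D {j | D j ≤ D i} < ε}

theorem weight_lightElements_lt {N : ℕ} (D : PMF (Fin N)) {ε : ℝ} (hε : 0 < ε) :
    weight D (lightElements D ε) < ε := by
  classical
  rcases (lightElements D ε).eq_empty_or_nonempty with h | h
  · simpa [h, weight] using hε
  -- All light elements lie in the lower level set of the heaviest one.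
  · obtain ⟨i, hi, hmax⟩ := Finset.exists_max_image _ D h
    refine (weight_mono D fun j hj => ?_).trans_lt (Finset.mem_filter.1 hi).2
    exact Finset.mem_filter.2 ⟨Finset.mem_univ _, hmax j hj⟩

theorem lightElements_ssubset {N : ℕ} (D : PMF (Fin N)) {ε : ℝ} (hε : 0 < ε) (hε1 : ε < 1) :
    lightElements D ε ⊂ Finset.univ := by
  refine Finset.ssubset_univ_iff.2 fun h => ?_
  have := weight_lightElements_lt D hε
  rw [h, weight_univ] at this
  linarith

/-- The largest scale exponent that can matter, up to an additive constant. -/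
noncomputable def scaleBound (N : ℕ) (ε : ℝ) : ℕ := ⌈Real.logb 2 (N / ε)⌉₊

/-- The number of runs of each test. -/
noncomputable def runCount (N : ℕ) (ε δ : ℝ) : ℕ :=
  ⌈1536 / ε ^ 3 * Real.log ((4 * scaleBound N ε + 12) / δ)⌉₊

/-- The approximate evaluation algorithm. -/
noncomputable def approxEval (N : ℕ) (ε δ : ℝ) (i : Fin N) : CondAlg N EvalAnswer :=
  evalFrom i (2 * (runCount N ε δ * (ε / 24))) (runCount N ε δ) 0 (scaleBound N ε + 2)

theorem admissible_approxEval (N : ℕ) (ε δ : ℝ) (i : Fin N) : (approxEval N ε δ i).Admissible :=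
  (safe_evalFrom _ _ _ _ _ _).admissibleFrom

section Parameters

variable {N : ℕ} {ε δ : ℝ}

theorem log_scale_pos (hδ : 0 < δ) (hδ1 : δ < 1) :
    0 < Real.log ((4 * scaleBound N ε + 12) / δ) := by
  have : (0 : ℝ) ≤ scaleBound N ε := Nat.cast_nonneg _
  exact Real.log_pos ((one_lt_div hδ).2 (by linarith))

theorem runCount_pos (hε : 0 < ε) (hδ : 0 < δ) (hδ1 : δ < 1) : 0 < runCount N ε δ :=
  Nat.ceil_pos.2 (mul_pos (by positivity) (log_scale_pos hδ hδ1))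

/-- The factor is `2 * (K + 2)` for inaccurate answers over all `K + 2` scales plus `2` for
`UNKNOWN`, where `K = scaleBound N ε`. -/
theorem mul_countError_runCount_le (hε : 0 < ε) (hδ : 0 < δ) :
    (2 * (scaleBound N ε : ℝ) + 6) * countError ε (runCount N ε δ) ≤ δ := by
  set K : ℝ := ((scaleBound N ε : ℕ) : ℝ) with hK
  have hK0 : 0 ≤ K := Nat.cast_nonneg _
  have hm : 1536 / ε ^ 3 * Real.log ((4 * K + 12) / δ) ≤ runCount N ε δ := Nat.le_ceil _
  have hlog : Real.log ((4 * K + 12) / δ) ≤ runCount N ε δ * ε ^ 3 / 1536 := by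
    calc _ = 1536 / ε ^ 3 * Real.log ((4 * K + 12) / δ) * ε ^ 3 / 1536 := by field_simp
      _ ≤ _ := by gcongr
  have hexp : Real.exp (-(runCount N ε δ * ε ^ 3 / 1536)) ≤ δ / (4 * K + 12) := by
    calc _ ≤ Real.exp (-Real.log ((4 * K + 12) / δ)) := Real.exp_le_exp.2 (neg_le_neg hlog)
      _ = _ := by rw [Real.exp_neg, Real.exp_log (by positivity), inv_div]
  calc _ = (4 * K + 12) * Real.exp (-(runCount N ε δ * ε ^ 3 / 1536)) := by
        unfold countError; ring
    _ ≤ (4 * K + 12) * (δ / (4 * K + 12)) := by gcongr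
    _ = δ := by field_simp

/-- The scale is at least `1 / ε ^ 3`, so `log (1 / ε)`, which is absent from the main term, is
absorbed by the logarithmic factor of the soft-O. -/
theorem queryScale_bounds (hε : 0 < ε) (hε1 : ε < 1) (δ : ℝ) :
    0 ≤ Real.log (queryScale N ε δ) ∧ Real.logb 2 (1 / ε) ≤ Real.log (queryScale N ε δ) := by
  set a := max 1 (Real.logb 2 N)
  set b := max 1 (Real.logb 2 (1 / δ))
  have hab : 1 ≤ a ^ 5 * b ^ 2 :=
    one_le_mul_of_one_le_of_one_le (one_le_pow₀ (le_max_left _ _)) (one_le_pow₀ (le_max_left _ _))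
  have h1 : (1 / ε) ^ 3 ≤ queryScale N ε δ := by
    unfold queryScale
    rw [div_pow, one_pow]
    gcongr
  have hinv : 1 ≤ 1 / ε := (one_le_div hε).2 hε1.le
  have hl0 : 0 ≤ Real.log (1 / ε) := Real.log_nonneg hinv
  have h3 : 3 * Real.log (1 / ε) ≤ Real.log (queryScale N ε δ) := by
    have := Real.log_le_log (by positivity) h1
    rwa [Real.log_pow] at this
  refine ⟨by linarith, le_trans ?_ h3⟩
  rw [Real.logb, div_le_iff₀ (Real.log_pos one_lt_two)]
  nlinarith [Real.log_two_gt_d9]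

theorem queries_approxEval_le (hε : 0 < ε) (hε1 : ε < 1) (hδ : 0 < δ) (hδ1 : δ < 1) (i : Fin N) :
    ((approxEval N ε δ i).queries : ℝ) ≤
      1000000 * (queryScale N ε δ * (1 + Real.log (queryScale N ε δ)) ^ 2) := by
  have hN : 1 ≤ N := i.pos
  obtain ⟨hf0, hf⟩ := queryScale_bounds hε hε1 δ
  set ℓ := Real.log (queryScale N ε δ) with hℓ
  set a := max 1 (Real.logb 2 N) with ha
  set b := max 1 (Real.logb 2 (1 / δ)) with hb
  have ha1 : 1 ≤ a := le_max_left _ _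
  have hb1 : 1 ≤ b := le_max_left _ _
  have hscale : queryScale N ε δ = a ^ 5 * b ^ 2 / ε ^ 3 := rfl
  set K : ℝ := ((scaleBound N ε : ℕ) : ℝ) with hK
  have hK0 : 0 ≤ K := Nat.cast_nonneg _
  set A := a * (1 + ℓ) with hA
  have hA1 : 1 ≤ A := one_le_mul_of_one_le_of_one_le ha1 (by linarith)
  have hKA : K ≤ 2 * A := by
    have hNR : (1 : ℝ) ≤ N := by exact_mod_cast hN
    have h0 : 0 ≤ Real.logb 2 (N / ε) :=
      Real.logb_nonneg one_lt_two ((one_le_div hε).2 (by linarith))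
    have h1 : K < Real.logb 2 (N / ε) + 1 := Nat.ceil_lt_add_one h0
    have h2 : Real.logb 2 (N / ε) = Real.logb 2 N + Real.logb 2 (1 / ε) := by
      rw [← Real.logb_mul (by positivity) (by positivity)]
      congr 1
      ring
    have h3 : Real.logb 2 N ≤ a := le_max_right _ _
    nlinarith
  have hlog : Real.log ((4 * K + 12) / δ) ≤ 21 * (A * b) := by
    have h1 : Real.log ((4 * K + 12) / δ) = Real.log (4 * K + 12) + Real.log (1 / δ) := by
      rw [← Real.log_mul (by positivity) (by positivity)]
      congr 1
      ring
    -- This crude bound costs a power of `log N`, which the fifth power in the target leaves room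
    -- for.
    have h2 : Real.log (4 * K + 12) ≤ 4 * K + 12 := Real.log_le_self (by positivity)
    have h3 : Real.log (1 / δ) ≤ b := by
      refine le_trans ?_ (le_max_right _ _)
      have hl : 0 ≤ Real.log (1 / δ) := Real.log_nonneg ((one_le_div hδ).2 hδ1.le)
      rw [Real.logb, le_div_iff₀ (Real.log_pos one_lt_two)]
      nlinarith [Real.log_two_lt_d9]
    have h4 : A ≤ A * b := le_mul_of_one_le_right (by linarith) hb1
    have h5 : b ≤ A * b := le_mul_of_one_le_left (by linarith) hA1
    linarith
  have hAb : 1 ≤ A * b := one_le_mul_of_one_le_of_one_le hA1 hb1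
  have hε3 : ε ^ 3 ≤ 1 := pow_le_one₀ hε.le hε1.le
  have hm : (runCount N ε δ : ℝ) ≤ 33000 * (A * b) / ε ^ 3 := by
    have hlt := Nat.ceil_lt_add_one
      (mul_pos (a := 1536 / ε ^ 3) (by positivity) (log_scale_pos (N := N) (ε := ε) hδ hδ1)).le
    calc (runCount N ε δ : ℝ) ≤ 1536 / ε ^ 3 * Real.log ((4 * K + 12) / δ) + 1 := hlt.le
      _ ≤ 1536 / ε ^ 3 * (21 * (A * b)) + (A * b) / ε ^ 3 := by
          gcongr
          exact (one_le_div (by positivity)).2 (by linarith)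
      _ = 32257 * (A * b) / ε ^ 3 := by ring
      _ ≤ _ := by gcongr; norm_num
  calc ((approxEval N ε δ i).queries : ℝ) ≤ 3 * runCount N ε δ * (K + 2) := by
        have := queries_evalFrom_le i (2 * (runCount N ε δ * (ε / 24))) (runCount N ε δ)
          (scaleBound N ε + 2) 0
        rw [hK]
        unfold approxEval
        exact_mod_cast this
    _ ≤ 3 * (33000 * (A * b) / ε ^ 3) * (4 * A) := by gcongr; linarith
    _ = 396000 * ((a ^ 2 * b ^ 1 / ε ^ 3) * (1 + ℓ) ^ 2) := by rw [hA]; ring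
    -- The count needs only `a ^ 2 * b`; the larger powers are reached by `1 ≤ a` and `1 ≤ b`.
    _ ≤ 1000000 * ((a ^ 5 * b ^ 2 / ε ^ 3) * (1 + ℓ) ^ 2) := by
        gcongr <;> norm_num
    _ = _ := by rw [hscale]

end Parameters

/-! ### The simulator property -/

section Correctness

variable {N : ℕ} {D : PMF (Fin N)} {ε δ : ℝ} {i : Fin N}

/-- Outside the light elements, some scale makes both tests succeed with probability `Ω(ε)`. -/
theorem exists_good_scale (hε : 0 < ε) (hi : i ∉ lightElements D ε) :
    ∃ k < scaleBound N ε + 2, ε / 6 ≤ hitProb D k i ∧ ε / 6 ≤ missProb D k i := by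
  have hw : ε ≤ weight D {j | D j ≤ D i} := by
    by_contra h
    exact hi (Finset.mem_filter.2 ⟨Finset.mem_univ _, by convert not_le.1 h⟩)
  set d := (D i).toReal with hd
  -- At most `N` points, each of mass at most `d`, share the weight `ε`; this bounds the scale
  -- exponent.
  have hNd : ε ≤ N * d := by
    refine hw.trans ((Finset.sum_le_card_nsmul _ _ d fun j hj => ?_).trans ?_)
    · exact ENNReal.toReal_mono (D.apply_ne_top i) (Finset.mem_filter.1 hj).2
    · rw [nsmul_eq_mul]
      refine mul_le_mul_of_nonneg_right ?_ ENNReal.toReal_nonneg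
      exact_mod_cast (Finset.card_le_univ _).trans_eq (Fintype.card_fin N)
  have hNR : (0 : ℝ) < N := by exact_mod_cast i.pos
  have hd0 : 0 < d := by
    by_contra h
    nlinarith
  have hd1 : d ≤ 1 := ENNReal.toReal_mono ENNReal.one_ne_top (D.coe_le_one i)
  obtain ⟨n, hn1, hn2⟩ := exists_nat_pow_near_of_lt_one hd0 hd1
    (y := (1 / 2 : ℝ)) (by norm_num) (by norm_num)
  refine ⟨n + 1, ?_, ?_⟩
  · have h2n : (2 : ℝ) ^ (n : ℝ) ≤ N / ε := by
      rw [Real.rpow_natCast, le_div_iff₀ hε]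
      calc (2 : ℝ) ^ n * ε ≤ 2 ^ n * (N * (1 / 2) ^ n) := by gcongr; nlinarith
        _ = N := by rw [mul_left_comm, ← mul_pow]; norm_num
    have hn : (n : ℝ) ≤ scaleBound N ε :=
      ((Real.le_logb_iff_rpow_le one_lt_two (by positivity)).2 h2n).trans (Nat.le_ceil _)
    have : n ≤ scaleBound N ε := by exact_mod_cast hn
    lia
  · have hhit := le_hitProb D hd0 hn1.le
    have hid := half_pow_mul_hitProb D (n + 1) i
    rw [← hd] at hid
    have hdp : d ≤ 2 * (1 / 2) ^ (n + 1) := hn2.trans_eq (by ring)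
    refine ⟨by linarith, ?_⟩
    -- By the identity and `d ≤ 2 * 2^(-(n + 1))`, the miss probability is at least half the hit
    -- probability.
    have h : d * (ε / 6) ≤ d * missProb D (n + 1) i := by
      rw [← hid]
      calc d * (ε / 6) ≤ 2 * (1 / 2) ^ (n + 1) * (ε / 6) := by gcongr
        _ = (1 / 2) ^ (n + 1) * (ε / 3) := by ring
        _ ≤ _ := by gcongr; linarith
    exact le_of_mul_le_mul_left h hd0

theorem le_prob_unknown_or_accurate (hε : 0 < ε) (hε1 : ε < 1) (hδ : 0 < δ) (hδ1 : δ < 1) :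
    1 - δ ≤ (approxEval N ε δ i).prob D ({.unknown} ∪ accurateAnswers D ε i) := by
  have h := prob_inaccurate_evalFrom_le (D := D) (i := i) hε hε1 (runCount_pos (N := N) hε hδ hδ1)
    (scaleBound N ε + 2) 0
  have hadd := prob_add_prob_compl (D := D) _ (admissible_approxEval N ε δ i)
    ({.unknown} ∪ accurateAnswers D ε i)
  have he := mul_countError_runCount_le (N := N) hε hδ
  have he0 : 0 ≤ countError ε (runCount N ε δ) := countError_nonneg
  push_cast at h
  unfold approxEval at hadd ⊢
  linarith

theorem le_prob_accurate (hε : 0 < ε) (hε1 : ε < 1) (hδ : 0 < δ) (hδ1 : δ < 1)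
    (hi : i ∉ lightElements D ε) :
    1 - δ ≤ (approxEval N ε δ i).prob D (accurateAnswers D ε i) := by
  have hm := runCount_pos (N := N) hε hδ hδ1
  have h := prob_inaccurate_evalFrom_le (D := D) (i := i) hε hε1 hm (scaleBound N ε + 2) 0
  obtain ⟨k, hk, hhit, hmiss⟩ := exists_good_scale hε hi
  have hu := prob_unknown_evalFrom_le hε hε1 hm hhit hmiss (scaleBound N ε + 2) 0 k.zero_le
    (by lia)
  have hadd := prob_add_prob_compl (D := D) _ (admissible_approxEval N ε δ i)
    ({.unknown} ∪ accurateAnswers D ε i)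
  have hun := prob_union_le D (approxEval N ε δ i) {.unknown} (accurateAnswers D ε i)
  have he := mul_countError_runCount_le (N := N) hε hδ
  push_cast at h
  unfold approxEval at hadd hun ⊢
  linarith

theorem isApproxEvalSimulator_approxEval (hε : 0 < ε) (hε1 : ε < 1) (hδ : 0 < δ) (hδ1 : δ < 1) :
    IsApproxEvalSimulator D ε δ (lightElements D ε) fun i => (approxEval N ε δ i).run D where
  ssubset_univ := lightElements_ssubset D hε hε1
  weight_lt := weight_lightElements_lt D hε
  never_fails i := run_none_of_admissibleFrom D _ ∅ (by simp) (admissible_approxEval N ε δ i)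
  of_notMem i hi := by
    have : accurateOutcomes D ε i = {o | ∃ v ∈ accurateAnswers D ε i, o = some v} := by
      ext o
      constructor
      · rintro ⟨a, rfl, h⟩
        exact ⟨_, ⟨a, rfl, h⟩, rfl⟩
      · rintro ⟨_, ⟨a, rfl, h⟩, rfl⟩
        exact ⟨a, rfl, h⟩
    rw [this, toOuterMeasure_run]
    exact ENNReal.ofReal_le_ofReal (le_prob_accurate hε hε1 hδ hδ1 hi)
  of_mem i _ := by
    have : {some EvalAnswer.unknown} ∪ accurateOutcomes D ε i =
        {o | ∃ v ∈ {EvalAnswer.unknown} ∪ accurateAnswers D ε i, o = some v} := by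
      ext o
      constructor
      · rintro (rfl | ⟨a, rfl, h⟩)
        · exact ⟨_, Or.inl rfl, rfl⟩
        · exact ⟨_, Or.inr ⟨a, rfl, h⟩, rfl⟩
      · rintro ⟨_, rfl | ⟨a, rfl, h⟩, rfl⟩
        · exact Or.inl rfl
        · exact Or.inr ⟨a, rfl, h⟩
    rw [this, toOuterMeasure_run]
    exact ENNReal.ofReal_le_ofReal (le_prob_unknown_or_accurate hε hε1 hδ hδ1)

end Correctness

end CondAlg

/-- There is one algorithm, given `N, ε, δ` and the input point `i`, and there are absolute
constants `C, k` (so that `C * f * (1 + log f) ^ k` is the soft-O of `f = queryScale N ε δ`), such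
that for every `D` over `[N]` and every `ε` there is a set `S`, depending on nothing else, with
respect to which the algorithm is for every `δ` an `(ε, δ)`-approximate `EVAL_D` simulator. -/
theorem theorem6p5 :
    ∃ (approxEval : (N : ℕ) → (ε δ : ℝ) → Fin N → CondAlg N EvalAnswer) (C : ℝ) (k : ℕ),
      ∀ (N : ℕ) (D : PMF (Fin N)) (ε : ℝ), 0 < ε → ε < 1 →
        ∃ S : Finset (Fin N), ∀ δ : ℝ, 0 < δ → δ < 1 →
          (∀ i : Fin N, (approxEval N ε δ i).Admissible ∧
            ((approxEval N ε δ i).queries : ℝ) ≤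
              C * (queryScale N ε δ * (1 + Real.log (queryScale N ε δ)) ^ k)) ∧
          IsApproxEvalSimulator D ε δ S (fun i => (approxEval N ε δ i).run D) := by

  refine ⟨CondAlg.approxEval, 1000000, 2, fun N D ε hε hε1 =>
    ⟨CondAlg.lightElements D ε, fun δ hδ hδ1 => ⟨fun i => ⟨?_, ?_⟩, ?_⟩⟩⟩
  · exact CondAlg.admissible_approxEval N ε δ i
  · exact CondAlg.queries_approxEval_le hε hε1 hδ hδ1 i
  · exact CondAlg.isApproxEvalSimulator_approxEval hε hε1 hδ hδ1
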